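/- Let $n \ge 1$ and let $1 \le k_1 \le k_2 \le \dots \le k_n$ be integers; write $\mathbf{k} = (k_1,\dots,k_n)$, $[m] = \{1,\dots,m\}$. For $1 \le r \le n$ let $$\mathcal{L}_{\mathbf{k},r} = \bigl\{ \{(x,y_x) : x \in X\} \;:\; X \subseteq [n],\ |X| = r,\ y_x \in [k_x] \text{ for each } x \in X \bigr\},$$ let $\mathcal{L}_{\mathbf{k},0} = \emptyset$, and let $\mathcal{L}_{\mathbf{k},\le n} = \bigcup_{r=0}^{n} \mathcal{L}_{\mathbf{k},r}$ be the family of all labeled sets. Call a family $\mathcal{A}$ of sets intersecting if $A \cap B \neq \emptyset$ for all $A, B \in \mathcal{A}$ (including $A = B$). Then $\mathcal{L}_{\mathbf{k},\le n}$ has the star property at $\{(1,1)\}$; that is, the star $\{A \in \mathcal{L}_{\mathbf{k},\le n} : (1,1) \in A\}$ is a largest intersecting sub-family of $\mathcal{L}_{\mathbf{k},\le n}$: it is intersecting, and every intersecting sub-family $\mathcal{A} \subseteq \mathcal{L}_{\mathbf{k},\le n}$ satisfies $$|\mathcal{A}| \le \bigl|\{A \in \mathcal{L}_{\mathbf{k},\le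 n} : (1,1) \in A\}\bigr|.$$ -/

import Mathlib

/-- The sub-family `𝓕(T) = {F ∈ 𝓕 : T ⊆ F}`. -/
def starAt {α : Type*} [DecidableEq α] (𝓕 : Finset (Finset α)) (T : Finset α) :
    Finset (Finset α) :=
  𝓕.filter fun F => T ⊆ F

/-- `𝓐` is `t`-intersecting: `|A ∩ B| ≥ t` for any `A, B ∈ 𝓐` (including `A = B`). -/
def IsTIntersecting {α : Type*} [DecidableEq α] (t : ℕ) (𝓐 : Finset (Finset α)) : Prop :=
  ∀ A ∈ 𝓐, ∀ B ∈ 𝓐, t ≤ (A ∩ B).card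

/-- `𝓐` is a largest `t`-intersecting sub-family of `𝓕`. -/
def IsLargestTIntersecting {α : Type*} [DecidableEq α] (t : ℕ)
    (𝓕 𝓐 : Finset (Finset α)) : Prop :=
  𝓐 ⊆ 𝓕 ∧ IsTIntersecting t 𝓐 ∧
    ∀ 𝓑 : Finset (Finset α), 𝓑 ⊆ 𝓕 → IsTIntersecting t 𝓑 → 𝓑.card ≤ 𝓐.card

/-- `𝓕` has the `t`-star property at `T`: `T` is a `t`-set and `𝓕(T)` is a largest
`t`-intersecting sub-family of `𝓕`. -/
def HasTStarPropertyAt {α : Type*} [DecidableEq α] (t : ℕ) (𝓕 : Finset (Finset α))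
    (T : Finset α) : Prop :=
  T.card = t ∧ IsLargestTIntersecting t 𝓕 (starAt 𝓕 T)

/-- The star property at `T` is the `1`-star property at `T`. -/
def HasStarPropertyAt {α : Type*} [DecidableEq α] (𝓕 : Finset (Finset α))
    (T : Finset α) : Prop :=
  HasTStarPropertyAt 1 𝓕 T

/-- The labeled sets with index set `X`: all `{(x, y_x) : x ∈ X}` with `y_x ∈ [k_x]`
for each `x ∈ X`. -/
def labeledSetsOn (k : ℕ → ℕ) (X : Finset ℕ) : Finset (Finset (ℕ × ℕ)) :=
  (X.pi fun x => Finset.Icc 1 (k x)).image fun y => X.attach.image fun x => (x.1, y x.1 x.2)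

/-- The family `𝓛_{𝐤,r}` of labeled `r`-sets for `𝐤 = (k 1, …, k n)`; by convention
`𝓛_{𝐤,0} = ∅`. -/
def labeledSets (n : ℕ) (k : ℕ → ℕ) (r : ℕ) : Finset (Finset (ℕ × ℕ)) :=
  if r = 0 then ∅
  else (Finset.powersetCard r (Finset.Icc 1 n)).biUnion fun X => labeledSetsOn k X

/-- The family `𝓛_{𝐤,≤r} = ⋃_{i=0}^{r} 𝓛_{𝐤,i}`. -/
def labeledSetsLE (n : ℕ) (k : ℕ → ℕ) (r : ℕ) : Finset (Finset (ℕ × ℕ)) :=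
  (Finset.range (r + 1)).biUnion fun i => labeledSets n k i

/-!
Add the label `0` at every index, to be read as "no label". Labeled sets of all sizes then become
the functions in `∏ᵢ ZMod (kᵢ + 1)` other than `0`, and two intersecting labeled sets become two
functions that agree somewhere. If `k a` is minimal, choose injections
`φᵢ : ZMod (k a + 1) ↪ ZMod (kᵢ + 1)`. For a fixed `g`, the translates `g + φ(j)` pairwise disagree
everywhere, so a pairwise agreeing family contains at most one of them, while the functions with a
prescribed value at `a` contain at least one. Averaging over `g` gives the bound.
-/

open Finset

theorem card_le_card_of_card_filter_perm_le {X J : Type*} [Finite X] [DecidableEq X] [Fintype J]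
    [Nonempty J] (σ : J → Equiv.Perm X) {B S : Finset X}
    (h : ∀ x, #{j | σ j x ∈ B} ≤ #{j | σ j x ∈ S}) : #B ≤ #S := by
  cases nonempty_fintype X
  have sum_card (C : Finset X) : ∑ x, #{j | σ j x ∈ C} = Fintype.card J * #C :=
    calc ∑ x, #{j | σ j x ∈ C} = ∑ j, ∑ x, if σ j x ∈ C then 1 else 0 := by
          simp only [card_filter]
          exact sum_comm
      _ = ∑ _j : J, ∑ x, if x ∈ C then 1 else 0 :=
          sum_congr rfl fun j _ => Equiv.sum_comp (σ j) fun x => if x ∈ C then 1 else 0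
      _ = Fintype.card J * #C := by simp
  have sum_le := sum_le_sum fun x (_ : x ∈ univ) => h x
  rw [sum_card, sum_card] at sum_le
  exact Nat.le_of_mul_le_mul_left sum_le Fintype.card_pos

theorem card_le_card_filter_apply_eq_of_pairwise_agree {ι : Type*} [Fintype ι] [DecidableEq ι]
    {G : ι → Type*} [∀ i, AddGroup (G i)] [∀ i, Fintype (G i)] [∀ i, DecidableEq (G i)] {a : ι}
    (ha : ∀ i, Fintype.card (G a) ≤ Fintype.card (G i)) (c : G a) {B : Finset (∀ i, G i)}
    (hB : ∀ g ∈ B, ∀ h ∈ B, ∃ i, g i = h i) : #B ≤ #{g : ∀ i, G i | g a = c} := by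
  let φ (i : ι) : G a ↪ G i := (Function.Embedding.nonempty_of_card_le (ha i)).some
  let shift (j : G a) : ∀ i, G i := fun i => φ i j
  refine card_le_card_of_card_filter_perm_le (fun j => Equiv.addRight (shift j)) fun g => ?_
  have at_most_one : #{j | g + shift j ∈ B} ≤ 1 := by
    refine card_le_one.2 fun j hj j' hj' => ?_
    obtain ⟨i, hi⟩ := hB _ (mem_filter.1 hj).2 _ (mem_filter.1 hj').2
    exact (φ i).injective (add_left_cancel hi)
  have at_least_one : ∃ j, (g + shift j) a = c := by
    obtain ⟨j, hj⟩ := Finite.surjective_of_injective (φ a).injective (-g a + c)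
    exact ⟨j, by simp only [shift, Pi.add_apply, hj, add_neg_cancel_left]⟩
  obtain ⟨j, hj⟩ := at_least_one
  exact at_most_one.trans (card_pos.2 ⟨j, by simpa using hj⟩)

theorem isTIntersecting_starAt {α : Type*} [DecidableEq α] (𝓕 : Finset (Finset α))
    (T : Finset α) : IsTIntersecting #T (starAt 𝓕 T) := fun _ hA _ hB =>
  card_le_card (subset_inter (mem_filter.1 hA).2 (mem_filter.1 hB).2)

theorem mem_labeledSetsOn {k : ℕ → ℕ} {X : Finset ℕ} {A : Finset (ℕ × ℕ)} :
    A ∈ labeledSetsOn k X ↔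
      ∃ y : ℕ → ℕ, (∀ x ∈ X, y x ∈ Icc 1 (k x)) ∧ X.image (fun x => (x, y x)) = A := by
  simp only [labeledSetsOn, mem_image, mem_pi]
  constructor
  · rintro ⟨y, hy, rfl⟩
    refine ⟨fun x => if h : x ∈ X then y x h else 0, fun x hx => ?_, ?_⟩
    · simpa only [dif_pos hx] using hy x hx
    · ext p
      simp only [mem_image, mem_attach, true_and, Subtype.exists]
      exact exists_congr fun x => exists_prop.symm.trans (exists_congr fun hx => by rw [dif_pos hx])
  · rintro ⟨y, hy, rfl⟩
    exact ⟨fun x _ => y x, hy, by ext p; simp⟩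

theorem mem_labeledSetsLE {n r : ℕ} {k : ℕ → ℕ} {A : Finset (ℕ × ℕ)} :
    A ∈ labeledSetsLE n k r ↔
      ∃ X ⊆ Icc 1 n, X.Nonempty ∧ #X ≤ r ∧ A ∈ labeledSetsOn k X := by
  simp only [labeledSetsLE, labeledSets, mem_biUnion, mem_range, Nat.lt_succ_iff]
  constructor
  · rintro ⟨s, hs, hA⟩
    by_cases hs0 : s = 0
    · rw [if_pos hs0] at hA
      exact absurd hA (notMem_empty A)
    · rw [if_neg hs0] at hA
      obtain ⟨X, hX, hAX⟩ := mem_biUnion.1 hA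
      obtain ⟨hXn, rfl⟩ := mem_powersetCard.1 hX
      exact ⟨X, hXn, card_ne_zero.1 hs0, hs, hAX⟩
  · rintro ⟨X, hXn, hX, hXr, hA⟩
    refine ⟨#X, hXr, ?_⟩
    rw [if_neg hX.card_ne_zero]
    exact mem_biUnion.2 ⟨X, mem_powersetCard.2 ⟨hXn, rfl⟩, hA⟩

theorem val_natCast_of_mem_Icc {m b : ℕ} (hb : b ∈ Icc 1 m) : (b : ZMod (m + 1)).val = b :=
  ZMod.val_natCast_of_lt (Nat.lt_succ_of_le (mem_Icc.1 hb).2)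

theorem natCast_ne_zero_of_mem_Icc {m b : ℕ} (hb : b ∈ Icc 1 m) : (b : ZMod (m + 1)) ≠ 0 := by
  rw [← ZMod.val_ne_zero, val_natCast_of_mem_Icc hb]
  exact Nat.one_le_iff_ne_zero.1 (mem_Icc.1 hb).1

/-- Labelings of part of the index set `I`, index `i` receiving a label in `{1, …, k i}` or none.
The value `0` means that `i` carries no label; residues are used so that labelings can be
translated. -/
abbrev PartialLabeling (I : Finset ℕ) (k : ℕ → ℕ) : Type :=
  ∀ i : I, ZMod (k i + 1)

namespace PartialLabeling

variable {I : Finset ℕ} {k : ℕ → ℕ}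

/-- The labeled set of a partial labeling: the pairs of a labeled index and its label. -/
def graph (g : PartialLabeling I k) : Finset (ℕ × ℕ) :=
  image (fun i : I => ((i : ℕ), (g i).val)) {i | g i ≠ 0}

theorem mem_graph {g : PartialLabeling I k} {a b : ℕ} :
    (a, b) ∈ g.graph ↔ ∃ h : a ∈ I, g ⟨a, h⟩ ≠ 0 ∧ (g ⟨a, h⟩).val = b := by
  simp only [graph, mem_image, mem_filter_univ, Prod.mk.injEq]
  constructor
  · rintro ⟨i, hi, rfl, rfl⟩
    exact ⟨i.2, hi, rfl⟩
  · rintro ⟨ha, hb, rfl⟩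
    exact ⟨⟨a, ha⟩, hb, rfl, rfl⟩

theorem mk_val_mem_graph {g : PartialLabeling I k} {i : I} (hi : g i ≠ 0) :
    ((i : ℕ), (g i).val) ∈ g.graph :=
  mem_graph.2 ⟨i.2, hi, rfl⟩

theorem graph_injective : Function.Injective (graph : PartialLabeling I k → _) := by
  intro g h hgh
  have eq_of_labeled {g h : PartialLabeling I k} (hgh : g.graph = h.graph) {i : I}
      (hi : g i ≠ 0) : g i = h i := by
    obtain ⟨_, -, hval⟩ := mem_graph.1 (hgh ▸ mk_val_mem_graph hi)
    exact (ZMod.val_injective _ hval).symm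
  funext i
  by_cases hg : g i = 0
  · by_cases hh : h i = 0
    · rw [hg, hh]
    · exact (eq_of_labeled hgh.symm hh).symm
  · exact eq_of_labeled hgh hg

theorem exists_apply_eq_of_graph_inter_nonempty {g h : PartialLabeling I k}
    (hgh : (g.graph ∩ h.graph).Nonempty) : ∃ i, g i = h i := by
  obtain ⟨⟨a, b⟩, hab⟩ := hgh
  obtain ⟨hg, hh⟩ := mem_inter.1 hab
  obtain ⟨ha, -, hgb⟩ := mem_graph.1 hg
  obtain ⟨_, -, hhb⟩ := mem_graph.1 hh
  exact ⟨⟨a, ha⟩, ZMod.val_injective _ (hgb.trans hhb.symm)⟩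

theorem mem_image_fst_graph {g : PartialLabeling I k} {a : ℕ} :
    a ∈ g.graph.image Prod.fst ↔ ∃ h : a ∈ I, g ⟨a, h⟩ ≠ 0 := by
  simp [mem_graph]

theorem image_fst_graph_subset (g : PartialLabeling I k) : g.graph.image Prod.fst ⊆ I :=
  fun _ ha => (mem_image_fst_graph.1 ha).1

theorem graph_mem_labeledSetsOn (g : PartialLabeling I k) :
    g.graph ∈ labeledSetsOn k (g.graph.image Prod.fst) := by
  refine mem_labeledSetsOn.2 ⟨fun x => if h : x ∈ I then (g ⟨x, h⟩).val else 0, fun x hx => ?_, ?_⟩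
  · obtain ⟨hxI, hgx⟩ := mem_image_fst_graph.1 hx
    simp only [dif_pos hxI, mem_Icc]
    exact ⟨Nat.one_le_iff_ne_zero.2 ((ZMod.val_ne_zero _).2 hgx), Nat.le_of_lt_succ (ZMod.val_lt _)⟩
  · ext ⟨a, b⟩
    rw [mem_image, mem_graph]
    simp only [mem_image_fst_graph, Prod.mk.injEq]
    constructor
    · rintro ⟨a, ⟨ha, hga⟩, rfl, rfl⟩
      exact ⟨ha, hga, by rw [dif_pos ha]⟩
    · rintro ⟨ha, hga, rfl⟩
      exact ⟨a, ⟨ha, hga⟩, rfl, dif_pos ha⟩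

theorem exists_graph_eq {X : Finset ℕ} (hX : X ⊆ I) {A : Finset (ℕ × ℕ)}
    (hA : A ∈ labeledSetsOn k X) : ∃ g : PartialLabeling I k, g.graph = A := by
  obtain ⟨y, hy, rfl⟩ := mem_labeledSetsOn.1 hA
  refine ⟨fun i => if (i : ℕ) ∈ X then (y i : ZMod (k i + 1)) else 0, ?_⟩
  ext ⟨a, b⟩
  simp only [mem_graph, mem_image, Prod.mk.injEq]
  constructor
  · rintro ⟨_, ha0, hab⟩
    have haX : a ∈ X := by_contra fun h => ha0 (if_neg h)
    rw [if_pos haX, val_natCast_of_mem_Icc (hy a haX)] at hab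
    exact ⟨a, haX, rfl, hab⟩
  · rintro ⟨a, haX, rfl, rfl⟩
    simp only [if_pos haX]
    exact ⟨hX haX, natCast_ne_zero_of_mem_Icc (hy a haX), val_natCast_of_mem_Icc (hy a haX)⟩

end PartialLabeling

theorem mem_labeledSetsLE_self_iff_exists_graph_eq {n : ℕ} {k : ℕ → ℕ} {A : Finset (ℕ × ℕ)} :
    A ∈ labeledSetsLE n k n ↔
      A.Nonempty ∧ ∃ g : PartialLabeling (Icc 1 n) k, g.graph = A := by
  rw [mem_labeledSetsLE]
  constructor
  · rintro ⟨X, hXn, hX, -, hA⟩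
    refine ⟨?_, PartialLabeling.exists_graph_eq hXn hA⟩
    obtain ⟨y, -, rfl⟩ := mem_labeledSetsOn.1 hA
    exact hX.image _
  · rintro ⟨hA, g, rfl⟩
    have hXn := g.image_fst_graph_subset
    exact ⟨_, hXn, hA.image _, by simpa using card_le_card hXn, g.graph_mem_labeledSetsOn⟩

theorem card_le_card_filter_graph_mem {n : ℕ} {k : ℕ → ℕ} {𝓑 : Finset (Finset (ℕ × ℕ))}
    (h𝓑 : 𝓑 ⊆ labeledSetsLE n k n) :
    #𝓑 ≤ #{g : PartialLabeling (Icc 1 n) k | g.graph ∈ 𝓑} := by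
  refine card_le_card_of_surjOn PartialLabeling.graph fun A hA => ?_
  obtain ⟨-, g, rfl⟩ := mem_labeledSetsLE_self_iff_exists_graph_eq.1 (h𝓑 hA)
  exact ⟨g, by simpa using hA, rfl⟩

theorem card_filter_apply_eq_le_card_starAt {n b : ℕ} {k : ℕ → ℕ} {a : Icc 1 n}
    (hb : b ∈ Icc 1 (k a)) :
    #{g : PartialLabeling (Icc 1 n) k | g a = b} ≤
      #(starAt (labeledSetsLE n k n) {((a : ℕ), b)}) := by
  refine card_le_card_of_injOn PartialLabeling.graph (fun g hg => ?_)
    PartialLabeling.graph_injective.injOn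
  have hga : g a = b := (mem_filter.1 hg).2
  have hab : ((a : ℕ), b) ∈ g.graph := by
    refine PartialLabeling.mem_graph.2 ⟨a.2, ?_⟩
    rw [hga]
    exact ⟨natCast_ne_zero_of_mem_Icc hb, val_natCast_of_mem_Icc hb⟩
  exact mem_coe.2 (mem_filter.2
    ⟨mem_labeledSetsLE_self_iff_exists_graph_eq.2 ⟨⟨_, hab⟩, g, rfl⟩, singleton_subset_iff.2 hab⟩)

theorem mainTheorem3_general {n : ℕ} {k : ℕ → ℕ} {a b : ℕ} (ha : a ∈ Icc 1 n)
    (hb : b ∈ Icc 1 (k a)) (hmin : ∀ i ∈ Icc 1 n, k a ≤ k i) :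
    HasStarPropertyAt (labeledSetsLE n k n) {(a, b)} := by
  refine ⟨card_singleton _, filter_subset _ _, isTIntersecting_starAt _ {(a, b)},
    fun 𝓑 h𝓑 hint => ?_⟩
  let a' : Icc 1 n := ⟨a, ha⟩
  have card_le (i : Icc 1 n) : Fintype.card (ZMod (k a' + 1)) ≤ Fintype.card (ZMod (k i + 1)) := by
    simpa only [ZMod.card, Nat.add_le_add_iff_right] using hmin i i.2
  let B : Finset (PartialLabeling (Icc 1 n) k) := {g | g.graph ∈ 𝓑}
  have agree : ∀ g ∈ B, ∀ h ∈ B, ∃ i, g i = h i := fun g hg h hh =>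
    PartialLabeling.exists_apply_eq_of_graph_inter_nonempty
      (card_pos.1 (hint _ (mem_filter.1 hg).2 _ (mem_filter.1 hh).2))
  calc #𝓑 ≤ #B := card_le_card_filter_graph_mem h𝓑
    _ ≤ #{g : PartialLabeling (Icc 1 n) k | g a' = b} :=
        card_le_card_filter_apply_eq_of_pairwise_agree card_le _ agree
    _ ≤ #(starAt (labeledSetsLE n k n) {(a, b)}) := card_filter_apply_eq_le_card_starAt (a := a') hb

theorem mainTheorem3 (n : ℕ) (hn : 1 ≤ n) (k : ℕ → ℕ) (hk1 : 1 ≤ k 1)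
    (hk : MonotoneOn k (Set.Icc 1 n)) :
    HasStarPropertyAt (labeledSetsLE n k n) {((1 : ℕ), (1 : ℕ))} :=
  mainTheorem3_general (left_mem_Icc.2 hn) (left_mem_Icc.2 hk1) fun _ hi =>
    hk ⟨le_rfl, hn⟩ (mem_Icc.1 hi) (mem_Icc.1 hi).1
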